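/- For a string $T=T[1]\cdots T[n]$ over an alphabet $\Sigma$, a bidirectional macro scheme of $T$ of size $b$ is a factorization $T=f_1\cdots f_b$ into non-empty phrases, $f_k=T[p_k..p_k+|f_k|-1]$, together with, for each phrase with $|f_k|>1$, a position $q_k\neq p_k$ such that $T[q_k..q_k+|f_k|-1]=f_k$ (the source of $f_k$, which may overlap $f_k$); phrases of length $1$ are ground phrases. It induces the map $F$ on $\{0,1,\dots,n\}$ with $F(0)=0$, $F(p_k)=0$ if $|f_k|=1$, and $F(p_k+j)=q_k+j$ if $|f_k|>1$ and $0\le j<|f_k|$. The scheme is valid if there is $m\ge 1$ with $F^m(i)=0$ for all $i\in[1,n]$. Let $b(T)$ be the smallest size of a valid bidirectional macro scheme of $T$. For an edit type $\mathrm{edit}\in\{\mathrm{sub},\mathrm{ins},\mathrm{del}\}$ let $$\mathsf{AS}_{\mathrm{edit}}(b,n)=\max\{\,b(T')-b(T)\;:\;T\in\Sigma^n,\ T' \text{ arises from } T \text{ by one edit operation of this type}\,\},$$ where the operations are: replacing one character by a different one, inserting one character, deleting one character (and $\mathsf{AS}_{\mathrm{edit}}(b,n)=0$ if there are no such $T,T'$).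 **Theorem.** $\mathsf{AS}_{\mathrm{edit}}(b,n)=O(\sqrt n)$ for each $\mathrm{edit}\in\{\mathrm{sub},\mathrm{ins},\mathrm{del}\}$. That is, there is a constant $C>0$, independent of the alphabet and of the edit type, such that for every alphabet $\Sigma$, every edit type and every $n\ge 1$, the maximum exists whenever there are such $T,T'$, and $|\mathsf{AS}_{\mathrm{edit}}(b,n)|\le C\sqrt n$. -/

import Mathlib

universe u

/-- A bidirectional macro scheme of the string `T`, of length `n = T.length`, with `size` phrases.
Positions of `T` are numbered `1, …, n`, so that the symbol at position `i` is `T[i - 1]?`.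
The factorization `T = f_1 ⋯ f_b` into non-empty phrases is given by its list of boundaries
`1 = p 0 < p 1 < ⋯ < p b = n + 1`: the `k`-th phrase occupies the positions
`p k, …, p (k + 1) - 1`. A phrase of length one is a ground phrase (a single character). A longer
phrase is a copy of the substring (its source) of the same length that starts at position `q k`,
to the left or to the right of the phrase's own starting position (the two may overlap).
The value of `q` at a ground phrase is not used. -/
structure BidirectionalMacroScheme {α : Type u} (T : List α) where
  size : ℕ
  p : Fin (size + 1) → ℕ
  q : Fin size → ℕ
  strictMono_p : StrictMono p
  p_first : p 0 = 1
  p_last : p (Fin.last size) = T.length + 1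
  source_bounds : ∀ k : Fin size, 1 < p k.succ - p k.castSucc →
    1 ≤ q k ∧ q k + (p k.succ - p k.castSucc) ≤ T.length + 1
  source_ne : ∀ k : Fin size, 1 < p k.succ - p k.castSucc → q k ≠ p k.castSucc
  copy : ∀ k : Fin size, 1 < p k.succ - p k.castSucc →
    ∀ j < p k.succ - p k.castSucc, T[p k.castSucc + j - 1]? = T[q k + j - 1]?

namespace BidirectionalMacroScheme

variable {α : Type u} {T : List α}

/-- The starting position of the `k`-th phrase. -/
def start (B : BidirectionalMacroScheme T) (k : Fin B.size) : ℕ := B.p k.castSucc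

/-- The length of the `k`-th phrase. -/
def len (B : BidirectionalMacroScheme T) (k : Fin B.size) : ℕ := B.p k.succ - B.p k.castSucc

open Classical in
/-- The map `F : [1, n] ∪ {0} → [1, n] ∪ {0}` induced by the scheme. It sends `0` and the positions
of ground phrases to `0`, and the position with offset `j` in a phrase of length at least two to the
position with offset `j` in the source of that phrase (see the three lemmas below). -/
noncomputable def F (B : BidirectionalMacroScheme T) (i : ℕ) : ℕ :=
  if h : ∃ k : Fin B.size, 1 < B.len k ∧ B.start k ≤ i ∧ i < B.start k + B.len k then
    B.q h.choose + (i - B.start h.choose)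
  else 0

/-- The scheme is valid if some iterate of `F` sends every position of `T` to `0`. -/
def Valid (B : BidirectionalMacroScheme T) : Prop :=
  ∃ m : ℕ, 1 ≤ m ∧ ∀ i : ℕ, 1 ≤ i → i ≤ T.length → B.F^[m] i = 0

lemma start_add_len (B : BidirectionalMacroScheme T) (k : Fin B.size) :
    B.start k + B.len k = B.p k.succ := by
  have := B.strictMono_p (Fin.castSucc_lt_succ (i := k))
  simp only [start, len]
  omega

lemma phrase_unique (B : BidirectionalMacroScheme T) {k l : Fin B.size} {i : ℕ}
    (hk : B.start k ≤ i) (hk' : i < B.start k + B.len k)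
    (hl : B.start l ≤ i) (hl' : i < B.start l + B.len l) : k = l := by
  rw [start_add_len] at hk' hl'
  have h1 := B.strictMono_p.lt_iff_lt.1 (lt_of_le_of_lt hk hl')
  have h2 := B.strictMono_p.lt_iff_lt.1 (lt_of_le_of_lt hl hk')
  simp only [Fin.lt_def, Fin.val_castSucc, Fin.val_succ] at h1 h2
  ext
  omega

lemma F_zero (B : BidirectionalMacroScheme T) : B.F 0 = 0 := by
  rw [F, dif_neg]
  rintro ⟨k, -, h, -⟩
  have : B.p 0 ≤ B.p k.castSucc := B.strictMono_p.monotone (Fin.zero_le _)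
  rw [B.p_first] at this
  simp only [start] at h
  omega

lemma F_ground (B : BidirectionalMacroScheme T) (k : Fin B.size) (hk : B.len k = 1) :
    B.F (B.start k) = 0 := by
  rw [F, dif_neg]
  rintro ⟨l, h1, h2, h3⟩
  have := B.phrase_unique (k := k) le_rfl (by omega) h2 h3
  subst this
  omega

lemma F_copy (B : BidirectionalMacroScheme T) (k : Fin B.size) (hk : 1 < B.len k)
    (j : ℕ) (hj : j < B.len k) : B.F (B.start k + j) = B.q k + j := by
  have h : ∃ l : Fin B.size, 1 < B.len l ∧ B.start l ≤ B.start k + j ∧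
      B.start k + j < B.start l + B.len l := ⟨k, hk, by omega, by omega⟩
  have e : h.choose = k :=
    B.phrase_unique h.choose_spec.2.1 h.choose_spec.2.2 (by omega) (by omega)
  rw [F, dif_pos h, e]
  omega

/-- The scheme all of whose phrases are ground. -/
def trivialScheme (T : List α) : BidirectionalMacroScheme T where
  size := T.length
  p k := k + 1
  q _ := 0
  strictMono_p a b h := by
    have : (a : ℕ) < b := h
    simpa using this
  p_first := by simp
  p_last := by simp
  source_bounds k h := by simp at h
  source_ne k h := by simp at h
  copy k h := by simp at h

lemma trivialScheme_valid (T : List α) : (trivialScheme T).Valid := by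
  refine ⟨1, le_rfl, fun i _ _ => ?_⟩
  rw [Function.iterate_one, F, dif_neg]
  rintro ⟨k, h, -⟩
  have h' : 1 < ((k : ℕ) + 1 + 1) - ((k : ℕ) + 1) := h
  omega

end BidirectionalMacroScheme

/-- `b(T)`: the smallest size of a valid bidirectional macro scheme of `T`. -/
noncomputable def bmsSize {α : Type u} (T : List α) : ℕ :=
  sInf {s | ∃ B : BidirectionalMacroScheme T, B.Valid ∧ B.size = s}

/-- The minimum in the definition of `bmsSize` is attained. -/
lemma exists_valid_size_eq_bmsSize {α : Type u} (T : List α) :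
    ∃ B : BidirectionalMacroScheme T, B.Valid ∧ B.size = bmsSize T :=
  Nat.sInf_mem (s := {s | ∃ B : BidirectionalMacroScheme T, B.Valid ∧ B.size = s})
    ⟨_, _, BidirectionalMacroScheme.trivialScheme_valid T, rfl⟩

/-- The three types of single-character edit operations. -/
inductive EditType
  | sub
  | ins
  | del

/-- `e.Step T T'`: the string `T'` arises from `T` by one edit operation of type `e`, that is, by
replacing one symbol by a different one, inserting one symbol, or deleting one symbol. -/
def EditType.Step {α : Type u} : EditType → List α → List α → Prop
  | .sub, T, T' => ∃ (x y : List α) (a b : α), a ≠ b ∧ T = x ++ a :: y ∧ T' = x ++ b :: y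
  | .ins, T, T' => ∃ (x y : List α) (a : α), T = x ++ y ∧ T' = x ++ a :: y
  | .del, T, T' => ∃ (x y : List α) (a : α), T = x ++ a :: y ∧ T' = x ++ y

/-- The differences `c(T') - c(T)`, where `T` has length `n` and `T'` arises from `T` by one edit
operation of type `e`. -/
def sensitivityDiffs {α : Type u} (e : EditType) (c : List α → ℕ) (n : ℕ) : Set ℤ :=
  {d | ∃ T T' : List α, T.length = n ∧ e.Step T T' ∧ d = (c T' : ℤ) - (c T : ℤ)}

/-- The worst-case additive sensitivity of the measure `c`: the maximum of the differences
`c(T') - c(T)` (and `0` if there are none). -/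
noncomputable def additiveSensitivity {α : Type u} (e : EditType) (c : List α → ℕ) (n : ℕ) : ℤ :=
  sSup (sensitivityDiffs e c n)

/-!
A macro scheme is handled as a map `G` on positions, together with a set `S` of starting positions
of phrases (`IsParse`). The minimal number of phrases is the minimal size of `S`, by
`exists_isParse_card_eq_bmsSize` and `IsParse.bmsSize_le`.

When the string is edited at a position `c`, a scheme survives once the phrase that contains `c` is
split there, and so is every phrase whose source contains `c` (`IsParse.exists_isParse_edit`). The
former costs a constant, and each phrase of the latter kind costs at most two. There may be many of these,
but their number can be reduced to `√(2n)` beforehand without changing the size of the scheme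
(`IsParse.exists_card_hits_sq_le`). Among all such phrases whose sources start at the same position,
keep the longest one and let the others copy from it, as they are prefixes of it. This prolongs the
chains of references by at most a factor of two, so the scheme stays valid. The phrases that are
kept have sources that contain `c` and start at distinct positions, so a set of `k` of them has
total length at least `1 + 2 + ⋯ + k`, and this is at most `n`, as phrases are disjoint
(`IsParse.card_sq_le_of_injOn`).

Thus `b` increases by at most `3 + 2√(2n)`, and applied to the inverse operation this bounds the
decrease as well.
-/

/-! ### Pointer maps -/

/-- A macro scheme in terms of positions. The map `G` sends a position to the position it is copied
from, or to `0` if it is stored explicitly, and `S` is a set of positions (numbered from `1`) that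
contains all starting positions of phrases: outside `S` the map `G` continues the phrase of the
preceding position. The rank function that decreases along `G` makes the scheme valid. A phrase of
length one may be a copy here, and `S` may have more elements than necessary. -/
structure IsParse {α : Type u} (T : List α) (G : ℕ → ℕ) (S : Finset ℕ) : Prop where
  mem_bounds : ∀ i ∈ S, 1 ≤ i ∧ i ≤ T.length
  target : ∀ i, 1 ≤ i → i ≤ T.length → G i ≠ 0 → G i ≤ T.length ∧ T[i - 1]? = T[G i - 1]?
  link : ∀ i, 1 ≤ i → i ≤ T.length → i ∉ S → 1 < i ∧ G (i - 1) ≠ 0 ∧ G i = G (i - 1) + 1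
  acyclic : ∃ r : ℕ → ℕ, ∀ i, 1 ≤ i → i ≤ T.length → G i ≠ 0 → r (G i) < r i

namespace BidirectionalMacroScheme

variable {α : Type u} {T : List α}

lemma exists_phrase (B : BidirectionalMacroScheme T) {i : ℕ} (h1 : 1 ≤ i) (h2 : i ≤ T.length) :
    ∃ k, B.start k ≤ i ∧ i < B.start k + B.len k := by
  obtain ⟨k, hk, hmax⟩ := Finset.exists_max_image
    (Finset.univ.filter fun k : Fin (B.size + 1) => B.p k ≤ i) id
    ⟨0, by simpa [B.p_first] using h1⟩
  simp only [Finset.mem_filter, Finset.mem_univ, true_and, id] at hk hmax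
  have hne : k ≠ Fin.last _ := by
    rintro rfl
    rw [B.p_last] at hk
    omega
  obtain ⟨l, rfl⟩ := Fin.exists_castSucc_eq.2 hne
  refine ⟨l, hk, ?_⟩
  rw [start_add_len]
  by_contra hcon
  exact absurd (hmax l.succ (by omega)) (not_le.2 Fin.castSucc_lt_succ)

lemma one_le_start (B : BidirectionalMacroScheme T) (k : Fin B.size) : 1 ≤ B.start k := by
  rw [← B.p_first]
  exact B.strictMono_p.monotone (Fin.zero_le _)

lemma len_pos (B : BidirectionalMacroScheme T) (k : Fin B.size) : 1 ≤ B.len k := by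
  have := B.strictMono_p (Fin.castSucc_lt_succ (i := k))
  rw [← start_add_len, ← start] at this
  omega

lemma start_add_len_le (B : BidirectionalMacroScheme T) (k : Fin B.size) :
    B.start k + B.len k ≤ T.length + 1 := by
  rw [start_add_len, ← B.p_last]
  exact B.strictMono_p.monotone (Fin.le_last _)

lemma exists_phrase_of_F_ne_zero (B : BidirectionalMacroScheme T) {i : ℕ} (h : B.F i ≠ 0) :
    ∃ k j, 1 < B.len k ∧ j < B.len k ∧ i = B.start k + j ∧ B.F i = B.q k + j := by
  rw [F] at h
  split_ifs at h with hk
  · obtain ⟨k, h1, h2, h3⟩ := hk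
    refine ⟨k, i - B.start k, h1, by omega, by omega, ?_⟩
    have := B.F_copy k h1 (i - B.start k) (by omega)
    rwa [Nat.add_sub_cancel' h2] at this
  · exact absurd rfl h

lemma start_injective (B : BidirectionalMacroScheme T) : Function.Injective B.start :=
  B.strictMono_p.injective.comp (Fin.castSucc_injective _)

lemma Valid.isParse {B : BidirectionalMacroScheme T} (hB : B.Valid) :
    IsParse T B.F (Finset.univ.image B.start) where
  mem_bounds i hi := by
    obtain ⟨k, -, rfl⟩ := Finset.mem_image.1 hi
    have h1 := B.one_le_start k
    have h2 := B.len_pos k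
    have h3 := B.start_add_len_le k
    omega
  target i _ _ h := by
    obtain ⟨k, j, h1, h2, rfl, h4⟩ := B.exists_phrase_of_F_ne_zero h
    have h5 := B.source_bounds k h1
    have h6 := B.copy k h1 j h2
    change _ ∧ B.q k + B.len k ≤ _ at h5
    rw [h4]
    exact ⟨by omega, h6⟩
  link i h1 h2 hi := by
    obtain ⟨k, h3, h4⟩ := B.exists_phrase h1 h2
    have h5 : B.start k ≠ i := fun h => hi (Finset.mem_image.2 ⟨k, Finset.mem_univ _, h⟩)
    have h6 := B.one_le_start k
    have h7 : 1 < B.len k := by omega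
    have h8 := (B.source_bounds k h7).1
    have h9 := B.F_copy k h7 (i - B.start k) (by omega)
    have h10 := B.F_copy k h7 (i - 1 - B.start k) (by omega)
    rw [Nat.add_sub_cancel' (by omega)] at h9 h10
    omega
  acyclic := by
    obtain ⟨m, -, hm⟩ := hB
    refine ⟨fun i => sInf {m | B.F^[m] i = 0}, fun i h1 h2 _ => ?_⟩
    have h : B.F^[sInf {m | B.F^[m] i = 0}] i = 0 :=
      Nat.sInf_mem (s := {m | B.F^[m] i = 0}) ⟨m, hm i h1 h2⟩
    change sInf {m | B.F^[m] (B.F i) = 0} < sInf {m | B.F^[m] i = 0}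
    generalize sInf {m | B.F^[m] i = 0} = t at h ⊢
    cases t with
    | zero =>
      rw [Function.iterate_zero_apply] at h
      omega
    | succ t =>
      rw [Function.iterate_succ_apply] at h
      exact Nat.lt_succ_of_le (Nat.sInf_le h)

end BidirectionalMacroScheme

lemma exists_isParse_card_eq_bmsSize {α : Type u} (T : List α) :
    ∃ G S, IsParse T G S ∧ S.card = bmsSize T := by
  obtain ⟨B, hB, hs⟩ := exists_valid_size_eq_bmsSize T
  refine ⟨_, _, hB.isParse, ?_⟩
  rw [Finset.card_image_of_injective _ B.start_injective, Finset.card_univ, Fintype.card_fin, hs]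

namespace IsParse

variable {α : Type u} {T : List α} {G : ℕ → ℕ} {S : Finset ℕ}

lemma mono (h : IsParse T G S) {S' : Finset ℕ} (hS : S ⊆ S')
    (hb : ∀ i ∈ S', 1 ≤ i ∧ i ≤ T.length) : IsParse T G S' where
  mem_bounds := hb
  target := h.target
  link i h1 h2 h3 := h.link i h1 h2 fun h4 => h3 (hS h4)
  acyclic := h.acyclic

lemma ne_self (h : IsParse T G S) {i : ℕ} (h1 : 1 ≤ i) (h2 : i ≤ T.length) : G i ≠ i := by
  intro hi
  obtain ⟨r, hr⟩ := h.acyclic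
  have := hr i h1 h2 (by omega)
  rw [hi] at this
  exact lt_irrefl _ this

lemma one_mem (h : IsParse T G S) (hT : 1 ≤ T.length) : 1 ∈ S := by
  by_contra h1
  exact absurd (h.link 1 le_rfl hT h1).1 (lt_irrefl _)

/-- Along a stretch that contains no starting position after its first element, `G` is a
translation. -/
lemma translate (h : IsParse T G S) {s : ℕ} (hs : 1 ≤ s) (j : ℕ) (hj : s + j ≤ T.length)
    (hS : ∀ i, s < i → i ≤ s + j → i ∉ S) : G (s + j) = G s + j ∧ (0 < j → G s ≠ 0) := by
  induction j with
  | zero => simp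
  | succ j ih =>
    obtain ⟨h1, h2⟩ := ih (by omega) fun i hi hi' => hS i hi (by omega)
    obtain ⟨-, h3, h4⟩ := h.link (s + (j + 1)) (by omega) hj (hS _ (by omega) le_rfl)
    rw [show s + (j + 1) - 1 = s + j by omega] at h3 h4
    refine ⟨by omega, fun _ => ?_⟩
    rcases Nat.eq_zero_or_pos j with rfl | hj'
    · simpa using h3
    · exact h2 hj'

lemma bmsSize_le (h : IsParse T G S) : bmsSize T ≤ S.card := by
  set n := T.length with hn
  have hnot : n + 1 ∉ S := fun hm => by have := h.mem_bounds _ hm; omega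
  have hc : (insert (n + 1) S).card = S.card + 1 := Finset.card_insert_of_notMem hnot
  set p : Fin (S.card + 1) ↪o ℕ := (insert (n + 1) S).orderEmbOfFin hc with hp
  have hmem : ∀ k, p k ∈ insert (n + 1) S := fun k => Finset.orderEmbOfFin_mem _ hc k
  have hsurj : ∀ x ∈ insert (n + 1) S, ∃ k, p k = x := fun x hx => by
    have : x ∈ Set.range p := by rw [hp, Finset.range_orderEmbOfFin]; exact hx
    exact this
  have hbd : ∀ k, 1 ≤ p k ∧ p k ≤ n + 1 := fun k => by
    rcases Finset.mem_insert.1 (hmem k) with hk | hk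
    · omega
    · have := h.mem_bounds _ hk; omega
  have hfirst : p 0 = 1 := by
    obtain ⟨k, hk⟩ : ∃ k, p k = 1 := by
      refine hsurj 1 ?_
      rcases Nat.eq_zero_or_pos n with h0 | h0
      · simp [h0]
      · exact Finset.mem_insert_of_mem (h.one_mem h0)
    have := p.monotone (Fin.zero_le k)
    have := (hbd 0).1
    omega
  have hlast : p (Fin.last _) = n + 1 := by
    obtain ⟨k, hk⟩ := hsurj (n + 1) (Finset.mem_insert_self _ _)
    have := p.monotone (Fin.le_last k)
    have := (hbd (Fin.last _)).2
    omega
  have hlt : ∀ k : Fin S.card, p k.castSucc < p k.succ := fun k =>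
    p.strictMono Fin.castSucc_lt_succ
  have hgap : ∀ (k : Fin S.card) (i : ℕ), p k.castSucc < i → i < p k.succ → i ∉ S := by
    intro k i h1 h2 hi
    obtain ⟨l, rfl⟩ := hsurj i (Finset.mem_insert_of_mem hi)
    have h3 := p.lt_iff_lt.1 h1
    have h4 := p.lt_iff_lt.1 h2
    simp only [Fin.lt_def, Fin.val_castSucc, Fin.val_succ] at h3 h4
    omega
  have htr : ∀ (k : Fin S.card) (j : ℕ), j < p k.succ - p k.castSucc →
      G (p k.castSucc + j) = G (p k.castSucc) + j ∧ (0 < j → G (p k.castSucc) ≠ 0) := by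
    intro k j hj
    have := (hbd k.succ).2
    exact h.translate (hbd _).1 j (by omega) fun i h1 h2 => hgap k i h1 (by omega)
  have hne : ∀ k : Fin S.card, 1 < p k.succ - p k.castSucc → G (p k.castSucc) ≠ 0 :=
    fun k hk => (htr k 1 hk).2 one_pos
  let B : BidirectionalMacroScheme T :=
    { size := S.card
      p := p
      q := fun k => G (p k.castSucc)
      strictMono_p := p.strictMono
      p_first := hfirst
      p_last := hlast
      source_bounds := fun k hk => by
        have h1 := hne k hk
        have h2 := htr k (p k.succ - p k.castSucc - 1) (by omega)
        have h3 := hbd k.succ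
        have h4 := hbd k.castSucc
        have h5 := (h.target (p k.castSucc + (p k.succ - p k.castSucc - 1))
          (by omega) (by omega) (by omega)).1
        omega
      source_ne := fun k hk => by
        have := hbd k.succ
        exact h.ne_self (hbd _).1 (by omega)
      copy := fun k hk j hj => by
        have h1 := hne k hk
        have h2 := (htr k j hj).1
        have h3 := hbd k.succ
        have h4 := hbd k.castSucc
        rw [← h2]
        exact (h.target _ (by omega) (by omega) (by omega)).2 }
  have hF : ∀ i, B.F i = 0 ∨ B.F i = G i := by
    intro i
    by_cases hi : B.F i = 0
    · exact Or.inl hi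
    · obtain ⟨k, j, _, h2, rfl, h4⟩ := B.exists_phrase_of_F_ne_zero hi
      exact Or.inr (h4.trans (htr k j h2).1.symm)
  obtain ⟨r, hr⟩ := h.acyclic
  have hzero : ∀ m, B.F^[m] 0 = 0 := fun m => Function.iterate_fixed B.F_zero m
  have hit : ∀ m i, i ≤ n → r i < m → B.F^[m] i = 0 := by
    intro m
    induction m with
    | zero => intro i _ h; omega
    | succ m ih =>
      intro i hi hm
      rw [Function.iterate_succ_apply]
      rcases Nat.eq_zero_or_pos i with rfl | hi0
      · rw [B.F_zero, hzero]
      rcases hF i with h0 | hG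
      · rw [h0, hzero]
      · by_cases h0 : G i = 0
        · rw [hG, h0, hzero]
        · have := hr i hi0 hi h0
          rw [hG]
          exact ih _ (h.target i hi0 hi h0).1 (by omega)
  refine Nat.sInf_le ⟨B, ⟨(Finset.range (n + 1)).sup r + 1, by omega, fun i _ h2 => ?_⟩, rfl⟩
  exact hit _ i h2 (Nat.lt_succ_of_le (Finset.le_sup (f := r) (Finset.mem_range.2 (by omega))))

end IsParse

/-! ### Few phrases copy from a given position -/

lemma card_sq_le_two_mul_sum (A : Finset ℕ) : A.card ^ 2 ≤ 2 * ∑ a ∈ A, (a + 1) := by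
  induction A using Finset.induction_on_max with
  | empty => simp
  | insert a A ha ih =>
    have hA : a ∉ A := fun h => lt_irrefl _ (ha a h)
    have hc : A.card ≤ a := by
      simpa using Finset.card_le_card fun x hx => Finset.mem_range.2 (ha x hx)
    rw [Finset.card_insert_of_notMem hA, Finset.sum_insert hA]
    nlinarith

/-- The greatest element of `S` that is at most `t`, or `0` if there is none. -/
def phraseStart (S : Finset ℕ) (t : ℕ) : ℕ := Nat.findGreatest (· ∈ S) t

/-- The phrase of `S` that starts at `s` extends at least to offset `j`, in a string of length `n`. -/
def Reaches (S : Finset ℕ) (n s j : ℕ) : Prop := s + j ≤ n ∧ ∀ i, s < i → i ≤ s + j → i ∉ S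

lemma phraseStart_le (S : Finset ℕ) (t : ℕ) : phraseStart S t ≤ t := Nat.findGreatest_le _

lemma phraseStart_add {S : Finset ℕ} {n s j : ℕ} (hs : s ∈ S) (h : Reaches S n s j) :
    phraseStart S (s + j) = s := by
  refine (Nat.findGreatest_eq_iff).2 ⟨by omega, fun _ => hs, fun i h1 h2 => h.2 i h1 h2⟩

/-- Among the phrases in `A` with a given source start, one is longest; `rep` selects it. -/
lemma exists_longest (S A : Finset ℕ) (n : ℕ) (G : ℕ → ℕ) (hA : ∀ s ∈ A, s ≤ n) :
    ∃ rep : ℕ → ℕ, ∀ s ∈ A, rep (G s) ∈ A ∧ G (rep (G s)) = G s ∧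
      ∀ j, Reaches S n s j → Reaches S n (rep (G s)) j := by
  classical
  have key : ∀ g, ∃ t, ∀ s ∈ A, G s = g → t ∈ A ∧ G t = g ∧
      ∀ j, Reaches S n s j → Reaches S n t j := by
    intro g
    by_cases hne : (A.filter fun s => G s = g).Nonempty
    · obtain ⟨t, ht, hmax⟩ := Finset.exists_max_image _
        (fun s => Nat.findGreatest (Reaches S n s) n) hne
      simp only [Finset.mem_filter] at ht hmax
      refine ⟨t, fun s hs hg => ⟨ht.1, ht.2, fun j hj => ?_⟩⟩
      have h1 : j ≤ Nat.findGreatest (Reaches S n t) n :=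
        (Nat.le_findGreatest (by have := hj.1; omega) hj).trans (hmax s ⟨hs, hg⟩)
      rcases Nat.eq_zero_or_pos j with rfl | hj0
      · exact ⟨hA t ht.1, fun i _ _ => by omega⟩
      · have h0 : Nat.findGreatest (Reaches S n t) n ≠ 0 := by omega
        have h2 := Nat.findGreatest_of_ne_zero (P := Reaches S n t) rfl h0
        exact ⟨by have := h2.1; omega, fun i hi hi' => h2.2 i hi (by omega)⟩
    · exact ⟨0, fun s hs hg => absurd ⟨s, Finset.mem_filter.2 ⟨hs, hg⟩⟩ hne⟩
  choose rep hrep using key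
  exact ⟨rep, fun s hs => hrep _ s hs rfl⟩

namespace IsParse

variable {α : Type u} {T : List α} {G : ℕ → ℕ} {S : Finset ℕ}

lemma phraseStart_mem (h : IsParse T G S) {t : ℕ} (h1 : 1 ≤ t) (h2 : t ≤ T.length) :
    phraseStart S t ∈ S :=
  Nat.findGreatest_spec (P := (· ∈ S)) h1 (h.one_mem (by omega))

lemma reaches_sub_phraseStart (S : Finset ℕ) {t n : ℕ} (h2 : t ≤ n) :
    Reaches S n (phraseStart S t) (t - phraseStart S t) := by
  have := phraseStart_le S t
  refine ⟨by omega, fun i hi hi' => ?_⟩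
  exact Nat.findGreatest_is_greatest (P := (· ∈ S)) hi (by omega)

/-- The positions copied from `c`. -/
def hits (T : List α) (G : ℕ → ℕ) (c : ℕ) : Finset ℕ :=
  (Finset.Icc 1 T.length).filter fun x => G x = c

/-- Each `x ∈ X` stands for the phrase that contains it. If the offsets of these positions in their
phrases are distinct, then `k` phrases have total length at least `1 + 2 + ⋯ + k`. As phrases are
disjoint, there are at most `√(2n)` of them. -/
lemma card_sq_le_of_injOn (h : IsParse T G S) {X : Finset ℕ}
    (hX : ∀ x ∈ X, 1 ≤ x ∧ x ≤ T.length)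
    (hinj : Set.InjOn (fun x => x - phraseStart S x) X)
    (hinj' : Set.InjOn (phraseStart S) X) : X.card ^ 2 ≤ 2 * T.length := by
  have hdisj : (X : Set ℕ).PairwiseDisjoint fun x => Finset.Icc (phraseStart S x) x := by
    intro x hx y hy hxy
    refine Finset.disjoint_left.2 fun t h1 h2 => hxy (hinj' hx hy ?_)
    simp only [Finset.mem_Icc] at h1 h2
    have key : ∀ z ∈ X, phraseStart S z ≤ t → t ≤ z → phraseStart S t = phraseStart S z := by
      intro z hz h3 h4
      have h5 := (reaches_sub_phraseStart S (hX z hz).2).2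
      have h6 := h.phraseStart_mem (hX z hz).1 (hX z hz).2
      have := (hX z hz).2
      have := phraseStart_add (n := T.length) (j := t - phraseStart S z) h6
        ⟨by omega, fun i hi hi' => h5 i hi (by omega)⟩
      rwa [Nat.add_sub_cancel' h3] at this
    rw [← key x hx h1.1 h1.2, key y hy h2.1 h2.2]
  have hsub : X.biUnion (fun x => Finset.Icc (phraseStart S x) x) ⊆ Finset.Icc 1 T.length := by
    intro t ht
    obtain ⟨x, hx, ht⟩ := Finset.mem_biUnion.1 ht
    have h1 := hX x hx
    have h2 := h.mem_bounds _ (h.phraseStart_mem h1.1 h1.2)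
    simp only [Finset.mem_Icc] at ht ⊢
    omega
  have hcard := Finset.card_le_card hsub
  rw [Finset.card_biUnion hdisj, Nat.card_Icc, Nat.add_sub_cancel] at hcard
  have h1 := card_sq_le_two_mul_sum (X.image fun x => x - phraseStart S x)
  rw [Finset.card_image_of_injOn hinj, Finset.sum_image hinj] at h1
  refine h1.trans (Nat.mul_le_mul_left 2 (le_trans (Finset.sum_le_sum fun x _ => ?_) hcard))
  have := phraseStart_le S x
  rw [Nat.card_Icc]
  omega

/-- The phrases whose sources start at the same position `g` and contain `c` are prefixes of the
longest of them, so that all the others can be copied from that one instead. Afterwards the phrases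
that copy from `c` do so at distinct offsets. The position `c` has to be a phrase of its own, so
that it does not occur in a new source. -/
lemma exists_card_hits_sq_le (h : IsParse T G S) {c : ℕ} (hc : 1 ≤ c)
    (hc0 : c ≤ T.length → c ∈ S) (hc1 : c + 1 ≤ T.length → c + 1 ∈ S) :
    ∃ G', IsParse T G' S ∧ (hits T G' c).card ^ 2 ≤ 2 * T.length := by
  classical
  set n := T.length with hn
  set A := (hits T G c).image (phraseStart S) with hA
  have hmemA : ∀ s, s ∈ A ↔ s ∈ S ∧ ∃ j, Reaches S n s j ∧ G (s + j) = c := by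
    intro s
    rw [hA, Finset.mem_image]
    constructor
    · rintro ⟨x, hx, rfl⟩
      simp only [hits, Finset.mem_filter, Finset.mem_Icc] at hx
      refine ⟨h.phraseStart_mem hx.1.1 hx.1.2, x - phraseStart S x,
        reaches_sub_phraseStart S hx.1.2, ?_⟩
      rw [Nat.add_sub_cancel' (phraseStart_le S x)]
      exact hx.2
    · rintro ⟨hs, j, hj, hG⟩
      refine ⟨s + j, ?_, phraseStart_add hs hj⟩
      have := h.mem_bounds s hs
      simp only [hits, Finset.mem_filter, Finset.mem_Icc]
      exact ⟨⟨by omega, hj.1⟩, hG⟩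
  have hAS : ∀ s ∈ A, s ∈ S := fun s hs => ((hmemA s).1 hs).1
  have htr : ∀ s ∈ S, ∀ j, Reaches S n s j → G (s + j) = G s + j ∧ (0 < j → G s ≠ 0) :=
    fun s hs j hj => h.translate (h.mem_bounds s hs).1 j hj.1 hj.2
  have hApos : ∀ s ∈ A, G s ≠ 0 := by
    intro s hs
    obtain ⟨h1, j, h2, h3⟩ := (hmemA s).1 hs
    obtain ⟨h4, h5⟩ := htr s h1 j h2
    rcases Nat.eq_zero_or_pos j with rfl | hj
    · omega
    · exact h5 hj
  have hcA : ∀ s ∈ A, ∀ j, Reaches S n s j → s + j ≠ c := by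
    intro s hs j hj hsj
    have h1 := hAS s hs
    have h2 := phraseStart_add h1 hj
    have h3 : Reaches S n c 0 := ⟨by have := hj.1; omega, fun i _ _ => by omega⟩
    have h4 := phraseStart_add (hc0 (by have := hj.1; omega)) h3
    rw [Nat.add_zero, ← hsj, h2] at h4
    obtain ⟨-, k, h5, h6⟩ := (hmemA s).1 hs
    rcases Nat.eq_zero_or_pos k with rfl | hk
    · have := (h.mem_bounds s h1)
      exact h.ne_self this.1 this.2 (by rw [Nat.add_zero] at h6; omega)
    · have := h5.1
      have := h5.2 (c + 1) (by omega) (by omega)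
      exact this (hc1 (by omega))
  obtain ⟨rep, hrep⟩ := exists_longest S A n G fun s hs => (h.mem_bounds s (hAS s hs)).2
  set st := phraseStart S with hst
  set mv : ℕ → Prop := fun s => s ∈ A ∧ rep (G s) ≠ s with hmv
  set G' : ℕ → ℕ := fun t => if mv (st t) then rep (G (st t)) + (t - st t) else G t with hG'
  -- Every position is given by a starting position and an offset.
  have hdec : ∀ t, 1 ≤ t → t ≤ n → ∃ s j, s ∈ S ∧ Reaches S n s j ∧ t = s + j := fun t h1 h2 =>
    ⟨st t, t - st t, h.phraseStart_mem h1 h2, reaches_sub_phraseStart S h2,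
      (Nat.add_sub_cancel' (phraseStart_le S t)).symm⟩
  have hmove : ∀ s ∈ S, ∀ j, Reaches S n s j → mv s → G' (s + j) = rep (G s) + j := by
    intro s hs j hj hm
    simp only [hG', hst, phraseStart_add hs hj, if_pos hm, Nat.add_sub_cancel_left]
  have hstay : ∀ s ∈ S, ∀ j, Reaches S n s j → ¬ mv s → G' (s + j) = G (s + j) := by
    intro s hs j hj hm
    simp only [hG', hst, phraseStart_add hs hj, if_neg hm]
  have hGrep : ∀ s ∈ A, ∀ j, Reaches S n s j →
      Reaches S n (rep (G s)) j ∧ G (rep (G s) + j) = G (s + j) ∧ G (s + j) ≠ 0 := by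
    intro s hs j hj
    obtain ⟨h1, h2, h3⟩ := hrep s hs
    have h4 := hApos s hs
    refine ⟨h3 j hj, ?_, ?_⟩
    · rw [(htr s (hAS s hs) j hj).1, (htr _ (hAS _ h1) j (h3 j hj)).1, h2]
    · rw [(htr s (hAS s hs) j hj).1]
      omega
  refine ⟨G', ⟨h.mem_bounds, ?_, ?_, ?_⟩, ?_⟩
  · intro t h1 h2 h3
    obtain ⟨s, j, hs, hj, rfl⟩ := hdec t h1 h2
    by_cases hm : mv s
    · obtain ⟨h4, h5, h6⟩ := hGrep s hm.1 j hj
      rw [hmove s hs j hj hm]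
      have h7 := h.mem_bounds _ (hAS _ (hrep s hm.1).1)
      have h8 := h4.1
      refine ⟨h8, ?_⟩
      rw [(h.target _ h1 h2 h6).2, (h.target (rep (G s) + j) (by omega) h8 (by rwa [h5])).2, h5]
    · rw [hstay s hs j hj hm] at h3 ⊢
      exact h.target _ h1 h2 h3
  · intro t h1 h2 h3
    obtain ⟨h4, h5, h6⟩ := h.link t h1 h2 h3
    refine ⟨h4, ?_⟩
    obtain ⟨s, j, hs, hj, rfl⟩ := hdec t h1 h2
    cases j with
    | zero => exact absurd hs h3
    | succ j =>
      have hj' : Reaches S n s j := ⟨by have := hj.1; omega, fun i hi hi' => hj.2 i hi (by omega)⟩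
      rw [show s + (j + 1) - 1 = s + j by omega] at h5 h6 ⊢
      by_cases hm : mv s
      · rw [hmove s hs _ hj hm, hmove s hs _ hj' hm]
        have := h.mem_bounds _ (hAS _ (hrep s hm.1).1)
        omega
      · rw [hstay s hs _ hj hm, hstay s hs _ hj' hm]
        exact ⟨h5, h6⟩
  · obtain ⟨r, hr⟩ := h.acyclic
    -- A redirected position and its new target have the same image under `G`, and the target is not
    -- redirected, so that the detour costs one additional step.
    refine ⟨fun t => if G t = 0 then 0 else 2 * r (G t) + 1 + if mv (st t) then 1 else 0, ?_⟩
    intro t h1 h2 h3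
    obtain ⟨s, j, hs, hj, rfl⟩ := hdec t h1 h2
    have hst' : st (s + j) = s := phraseStart_add hs hj
    by_cases hm : mv s
    · obtain ⟨h4, h5, h6⟩ := hGrep s hm.1 j hj
      obtain ⟨h7, h8, -⟩ := hrep s hm.1
      have h9 : st (rep (G s) + j) = rep (G s) := phraseStart_add (hAS _ h7) h4
      have h10 : ¬ mv (rep (G s)) := fun hm' => hm'.2 (by rw [h8])
      simp only [hmove s hs j hj hm, h5, if_neg h6, h9, if_neg h10, hst', if_pos hm]
      omega
    · rw [hstay s hs j hj hm] at h3 ⊢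
      simp only [if_neg h3, hst', if_neg hm]
      obtain ⟨h4, -⟩ := h.target _ h1 h2 h3
      by_cases h5 : G (G (s + j)) = 0
      · rw [if_pos h5]
        omega
      · have := hr (G (s + j)) (by omega) h4 h5
        rw [if_neg h5]
        split_ifs <;> omega
  · -- A position copied from `c` lies in a selected phrase, which is determined by its offset.
    have key : ∀ x ∈ hits T G' c, 1 ≤ x ∧ x ≤ n ∧ rep (G (st x)) = st x ∧
        c = G (st x) + (x - st x) := by
      intro x hx
      simp only [hits, Finset.mem_filter, Finset.mem_Icc] at hx
      obtain ⟨⟨h1, h2⟩, h3⟩ := hx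
      obtain ⟨s, j, hs, hj, rfl⟩ := hdec x h1 h2
      have hst' : st (s + j) = s := phraseStart_add hs hj
      rw [hst', Nat.add_sub_cancel_left]
      by_cases hm : mv s
      · rw [hmove s hs j hj hm] at h3
        exact absurd h3 (hcA _ (hrep s hm.1).1 j (hGrep s hm.1 j hj).1)
      · rw [hstay s hs j hj hm] at h3
        have hsA : s ∈ A := (hmemA s).2 ⟨hs, j, hj, h3⟩
        refine ⟨h1, h2, ?_, ?_⟩
        · by_contra h4
          exact hm ⟨hsA, h4⟩
        · rw [← h3, (htr s hs j hj).1]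
    have hle : ∀ t, st t ≤ t := phraseStart_le S
    refine h.card_sq_le_of_injOn (fun x hx => ⟨(key x hx).1, (key x hx).2.1⟩) ?_ ?_
    · intro x hx y hy (hxy : x - st x = y - st y)
      obtain ⟨-, -, h1, h2⟩ := key x hx
      obtain ⟨-, -, h3, h4⟩ := key y hy
      have h5 : G (st x) = G (st y) := by omega
      have h6 : st x = st y := by rw [← h1, ← h3, h5]
      have := hle x
      have := hle y
      omega
    · intro x hx y hy (hxy : st x = st y)
      obtain ⟨-, -, h1, h2⟩ := key x hx
      obtain ⟨-, -, h3, h4⟩ := key y hy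
      rw [hxy] at h2
      have := hle x
      have := hle y
      omega

end IsParse

/-! ### The effect of an edit -/

namespace IsParse

variable {α : Type u} {G : ℕ → ℕ} {S : Finset ℕ}

/-- Splits every phrase whose source meets the edited place. The hypotheses on `S` say that the
phrase that contains this place has been split already. If `u` is empty, then only a source that
continues from the end of `x` to the beginning of `y` is disrupted; splitting a phrase whose source
starts with `y` as well does no harm. -/
lemma exists_isParse_edit {x u v y : List α} (hu : u.length ≤ 1) (hv : v.length ≤ 1)
    (h : IsParse (x ++ u ++ y) G S)
    (h1 : x.length + 1 ≤ (x ++ u ++ y).length → x.length + 1 ∈ S)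
    (h2 : x.length + 2 ≤ (x ++ u ++ y).length → x.length + 2 ∈ S) :
    ∃ G' S', IsParse (x ++ v ++ y) G' S' ∧
      S'.card ≤ S.card + 2 * (hits (x ++ u ++ y) G (x.length + 1)).card + 1 := by
  classical
  have hget : ∀ (w : List α) (t : ℕ), 1 ≤ t → (x ++ w ++ y)[t - 1]? =
      if t ≤ x.length then x[t - 1]? else if t ≤ x.length + w.length then w[t - 1 - x.length]?
        else y[t - 1 - x.length - w.length]? := by
    intro w t ht
    rw [List.getElem?_append, List.getElem?_append, List.length_append]
    split_ifs <;> first | rfl | omega | (congr 1; omega)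
  have hnT : (x ++ u ++ y).length = x.length + u.length + y.length := by simp [Nat.add_assoc]
  have hnT' : (x ++ v ++ y).length = x.length + v.length + y.length := by simp [Nat.add_assoc]
  set H := hits (x ++ u ++ y) G (x.length + 1) with hH
  have hmemH : ∀ t, t ∈ H ↔ (1 ≤ t ∧ t ≤ (x ++ u ++ y).length) ∧ G t = x.length + 1 := by
    intro t
    simp only [hH, hits, Finset.mem_filter, Finset.mem_Icc]
  set n := (x ++ u ++ y).length
  set n' := (x ++ v ++ y).length
  set L := x.length
  set a := u.length
  set b := v.length
  -- The new position of an old one, and the old position of a new one; `0` if there is none.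
  set φ : ℕ → ℕ := fun t => if t ≤ L then t else if t ≤ L + a then 0 else t - a + b with hφ
  set ψ : ℕ → ℕ := fun t => if t ≤ L then t else if t ≤ L + b then 0 else t - b + a with hψ
  have hψ1 : ∀ t, 1 ≤ t → t ≤ n' → ψ t ≠ 0 → 1 ≤ ψ t ∧ ψ t ≤ n ∧ φ (ψ t) = t ∧
      (x ++ v ++ y)[t - 1]? = (x ++ u ++ y)[ψ t - 1]? := by
    intro t ht ht' h0
    have e1 : φ (ψ t) = t := by
      simp only [hψ, hφ] at h0 ⊢
      split_ifs at h0 ⊢ <;> omega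
    have e2 : ψ t ≤ n := by
      simp only [hψ] at h0 ⊢
      split_ifs at h0 ⊢ <;> omega
    refine ⟨by omega, e2, e1, ?_⟩
    rw [hget v t ht, hget u (ψ t) (by omega)]
    simp only [hψ] at h0 ⊢
    split_ifs at h0 ⊢ <;> first | rfl | omega | (congr 1; omega)
  have hφ1 : ∀ g, φ g ≠ 0 → g ≤ n → 1 ≤ φ g ∧ φ g ≤ n' ∧ ψ (φ g) = g := by
    intro g h0 hg
    simp only [hψ, hφ] at h0 ⊢
    split_ifs at h0 ⊢ <;> omega
  have hφ0 : φ 0 = 0 := by simp [hφ]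
  set S2 := S ∪ (H ∪ H.image (· + 1)) with hS2
  set G' : ℕ → ℕ := fun t => if ψ t = 0 then 0 else φ (G (ψ t)) with hG'
  refine ⟨G', (insert (L + 1) (S2.image φ)).filter fun t => 1 ≤ t ∧ t ≤ n', ⟨?_, ?_, ?_, ?_⟩, ?_⟩
  · intro i hi
    exact (Finset.mem_filter.1 hi).2
  · intro t ht ht' h0
    have hp : ψ t ≠ 0 := fun h => h0 (by simp [hG', h])
    simp only [hG', if_neg hp] at h0 ⊢
    obtain ⟨h3, h4, -, h5⟩ := hψ1 t ht ht' hp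
    have h6 : G (ψ t) ≠ 0 := fun h => h0 (by rw [h, hφ0])
    obtain ⟨h7, h8⟩ := h.target _ h3 h4 h6
    obtain ⟨h9, h10, h11⟩ := hφ1 _ h0 h7
    refine ⟨h10, ?_⟩
    rw [h5, h8, (hψ1 _ h9 h10 (by rw [h11]; exact h6)).2.2.2, h11]
  · intro t ht ht' hS
    simp only [Finset.mem_filter, Finset.mem_insert, Finset.mem_image, not_and_or, not_or] at hS
    obtain ⟨hL, hS⟩ := hS.resolve_right fun hb => by omega
    have hp : ψ t ≠ 0 := by simp only [hψ]; split_ifs <;> omega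
    obtain ⟨h3, h4, h5, -⟩ := hψ1 t ht ht' hp
    have h6 : ψ t ∉ S2 := fun hm => hS ⟨_, hm, h5⟩
    simp only [hS2, Finset.mem_union, Finset.mem_image, not_or] at h6
    obtain ⟨h7, h8, h9⟩ := h6
    obtain ⟨h10, h11, h12⟩ := h.link _ h3 h4 h7
    have h13 : G (ψ t) ≠ L + 1 := fun hh => h8 ((hmemH _).2 ⟨⟨h3, h4⟩, hh⟩)
    have h14 : G (ψ t - 1) ≠ L + 1 := fun hh =>
      h9 ⟨ψ t - 1, (hmemH _).2 ⟨⟨by omega, by omega⟩, hh⟩, by omega⟩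
    have h15 : ψ t ≠ L + 1 := fun hh => h7 (hh ▸ h1 (by omega))
    have h16 : ψ t ≠ L + 2 := fun hh => h7 (hh ▸ h2 (by omega))
    have h17 : ψ (t - 1) = ψ t - 1 := by
      simp only [hψ] at hp h15 h16 ⊢
      split_ifs at hp h15 h16 ⊢ <;> omega
    have h18 : 1 < t := by
      by_contra hcon
      have : t = 1 := by omega
      subst this
      simp only [hψ] at hp h10 h15 h16
      split_ifs at hp h10 h15 h16 <;> omega
    have h19 : ψ t - 1 ≠ 0 := by omega
    refine ⟨h18, ?_⟩
    simp only [hG', h17, if_neg hp, if_neg h19, h12]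
    rw [h12] at h13
    simp only [hφ]
    split_ifs <;> omega
  · obtain ⟨r, hr⟩ := h.acyclic
    refine ⟨fun t => r (ψ t), fun t ht ht' h0 => ?_⟩
    have hp : ψ t ≠ 0 := fun h => h0 (by simp [hG', h])
    simp only [hG', if_neg hp] at h0 ⊢
    obtain ⟨h3, h4, -, -⟩ := hψ1 t ht ht' hp
    have h6 : G (ψ t) ≠ 0 := fun h => h0 (by rw [h, hφ0])
    rw [(hφ1 _ h0 (h.target _ h3 h4 h6).1).2.2]
    exact hr _ h3 h4 h6
  · refine (Finset.card_filter_le _ _).trans ((Finset.card_insert_le _ _).trans ?_)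
    have h3 : (S2.image φ).card ≤ S2.card := Finset.card_image_le
    have h4 : S2.card ≤ S.card + (H ∪ H.image (· + 1)).card := Finset.card_union_le _ _
    have h5 : (H ∪ H.image (· + 1)).card ≤ H.card + (H.image (· + 1)).card :=
      Finset.card_union_le _ _
    have h6 : (H.image (· + 1)).card ≤ H.card := Finset.card_image_le
    omega

end IsParse

lemma bmsSize_edit_le {α : Type u} (x u v y : List α) (hu : u.length ≤ 1) (hv : v.length ≤ 1) :
    ∃ k, k ^ 2 ≤ 2 * (x ++ u ++ y).length ∧
      bmsSize (x ++ v ++ y) ≤ bmsSize (x ++ u ++ y) + 2 * k + 3 := by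
  classical
  set T := x ++ u ++ y with hT
  obtain ⟨G, S, h, hS⟩ := exists_isParse_card_eq_bmsSize T
  set S₁ := S ∪ ({x.length + 1, x.length + 2} : Finset ℕ).filter (· ≤ T.length) with hS₁
  have h1 : IsParse T G S₁ := by
    refine h.mono Finset.subset_union_left fun i hi => ?_
    simp only [hS₁, Finset.mem_union, Finset.mem_filter, Finset.mem_insert,
      Finset.mem_singleton] at hi
    rcases hi with hi | hi
    · exact h.mem_bounds i hi
    · omega
  have hc : S₁.card ≤ S.card + 2 :=
    (Finset.card_union_le _ _).trans (Nat.add_le_add_left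
      ((Finset.card_filter_le _ _).trans Finset.card_le_two) _)
  have hm1 : x.length + 1 ≤ T.length → x.length + 1 ∈ S₁ := fun hle => by simp [hS₁, hle]
  have hm2 : x.length + 2 ≤ T.length → x.length + 2 ∈ S₁ := fun hle => by simp [hS₁, hle]
  obtain ⟨G₁, h2, hk⟩ := h1.exists_card_hits_sq_le (by omega) hm1 hm2
  obtain ⟨G₂, S₂, h3, h4⟩ := h2.exists_isParse_edit hu hv hm1 hm2
  rw [← hT] at h4
  have h5 := h3.bmsSize_le
  exact ⟨_, hk, by omega⟩

lemma EditType.Step.exists_append {α : Type u} {e : EditType} {T T' : List α} (h : e.Step T T') :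
    ∃ x u v y : List α, u.length ≤ 1 ∧ v.length ≤ 1 ∧ T = x ++ u ++ y ∧ T' = x ++ v ++ y := by
  cases e with
  | sub =>
    obtain ⟨x, y, a, b, -, rfl, rfl⟩ := h
    exact ⟨x, [a], [b], y, by simp⟩
  | ins =>
    obtain ⟨x, y, a, rfl, rfl⟩ := h
    exact ⟨x, [], [a], y, by simp⟩
  | del =>
    obtain ⟨x, y, a, rfl, rfl⟩ := h
    exact ⟨x, [a], [], y, by simp⟩

/-- The lower bound is the upper bound for the inverse operation. -/
lemma abs_le_of_mem_sensitivityDiffs {α : Type u} {e : EditType} {n : ℕ} (hn : 1 ≤ n) {d : ℤ}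
    (hd : d ∈ sensitivityDiffs e (bmsSize (α := α)) n) : |(d : ℝ)| ≤ 7 * √(n : ℝ) := by
  obtain ⟨T, T', hT, hstep, rfl⟩ := hd
  obtain ⟨x, u, v, y, hu, hv, rfl, rfl⟩ := hstep.exists_append
  obtain ⟨k, hk, h1⟩ := bmsSize_edit_le x u v y hu hv
  obtain ⟨l, hl, h2⟩ := bmsSize_edit_le x v u y hv hu
  have hlen : (x ++ v ++ y).length ≤ 2 * n := by
    simp only [List.length_append] at hT ⊢
    omega
  have hsq : ∀ m : ℕ, m ^ 2 ≤ 4 * n → (m : ℝ) ≤ 2 * √(n : ℝ) := by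
    intro m hm
    have h3 : (m : ℝ) ^ 2 ≤ 4 * n := by exact_mod_cast hm
    refine abs_le_of_sq_le_sq' ?_ (by positivity) |>.2
    rw [mul_pow, Real.sq_sqrt (Nat.cast_nonneg n)]
    linarith
  have hk' := hsq k (by omega)
  have hl' := hsq l (by omega)
  have hone : (1 : ℝ) ≤ √(n : ℝ) := Real.one_le_sqrt.2 (by exact_mod_cast hn)
  have h1' : (bmsSize (x ++ v ++ y) : ℝ) ≤ bmsSize (x ++ u ++ y) + 2 * k + 3 := by exact_mod_cast h1
  have h2' : (bmsSize (x ++ u ++ y) : ℝ) ≤ bmsSize (x ++ v ++ y) + 2 * l + 3 := by exact_mod_cast h2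
  push_cast
  rw [abs_le]
  constructor <;> linarith

theorem mainTheorem2 :
    ∃ C : ℝ, 0 < C ∧ ∀ (α : Type u) (e : EditType) (n : ℕ), 1 ≤ n →
      ((sensitivityDiffs e (bmsSize (α := α)) n).Nonempty →
        IsGreatest (sensitivityDiffs e (bmsSize (α := α)) n)
          (additiveSensitivity e (bmsSize (α := α)) n)) ∧
      |(additiveSensitivity e (bmsSize (α := α)) n : ℝ)| ≤ C * √(n : ℝ) := by
  refine ⟨7, by norm_num, fun α e n hn => ?_⟩
  have hbdd : BddAbove (sensitivityDiffs e (bmsSize (α := α)) n) := by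
    refine ⟨⌈7 * √(n : ℝ)⌉, fun d hd => ?_⟩
    have := (le_abs_self _).trans (abs_le_of_mem_sensitivityDiffs hn hd)
    exact_mod_cast this.trans (Int.le_ceil _)
  have hmem : (sensitivityDiffs e (bmsSize (α := α)) n).Nonempty →
      additiveSensitivity e (bmsSize (α := α)) n ∈ sensitivityDiffs e (bmsSize (α := α)) n :=
    fun hne => Int.csSup_mem hne hbdd
  refine ⟨fun hne => ⟨hmem hne, fun d hd => le_csSup hbdd hd⟩, ?_⟩
  rcases (sensitivityDiffs e (bmsSize (α := α)) n).eq_empty_or_nonempty with hempty | hne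
  · rw [additiveSensitivity, hempty, Int.csSup_empty, Int.cast_zero, abs_zero]
    positivity
  · exact abs_le_of_mem_sensitivityDiffs hn (hmem hne)
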